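/- Let $(R,\mathfrak m,k)$ be a one-dimensional commutative Noetherian Cohen-Macaulay local ring which is generically Gorenstein (that is, $R_{\mathfrak p}$ is Gorenstein for every minimal prime $\mathfrak p$) and not regular. Assume that every $\mathfrak m$-primary ideal $I$ of $R$ has a principal reduction, i.e. there are $x\in I$ and $n\ge 0$ with $xI^n=I^{n+1}$ (this holds, for example, if $k$ is infinite). Let $\omega_R$ be a canonical ideal of $R$, that is, an $\mathfrak m$-primary ideal which is isomorphic to a canonical module of $R$. Recall that $R$ is almost Gorenstein if it has a canonical ideal $I$ with $e_1(I)\le r(R)$, where $r(R)=\dim_k\operatorname{Ext}^1_R(k,R)$ is the type of $R$ and $e_1(I)$ is determined by $\ell_R(R/I^{n+1})=e_0(I)(n+1)-e_1(I)$ for all $n\gg 0$. A nonzero finitely generated torsion-free $R$-module $M$ has minimal multiplicity with respect to an $\mathfrak m$-primary ideal $I$ if $e_R(I,M)=\ell_R(IM/I^2M)$, where $e_R(I,M)=\lim_{n\to\infty}\ell_R(M/I^nM)/n$ is the Hilbert-Samuel multiplicity. Put $\mathfrak m^{*}=\operatorname{Hom}_R(\mathfrak m,R)$. Then the following conditions are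 equivalent: 1. $R$ is almost Gorenstein; 2. $\mathfrak m$ has minimal multiplicity with respect to $\omega_R$; 3. $\mathfrak m^{*}$ has minimal multiplicity with respect to $\omega_R$. -/

import Mathlib

open IsLocalRing CategoryTheory Filter Topology

universe u

noncomputable section

/-- A Noetherian local ring is Cohen-Macaulay if it admits a regular sequence whose length is the
Krull dimension of the ring. -/
def IsCohenMacaulayLocal (R : Type u) [CommRing R] [IsLocalRing R] [IsNoetherianRing R] : Prop :=
  ∃ rs : List R, RingTheory.Sequence.IsRegular R rs ∧
    ((rs.length : ℕ) : WithBot ℕ∞) = ringKrullDim R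

/-- A Noetherian local ring is Gorenstein if it has finite injective dimension over itself. -/
def IsGorensteinLocal (R : Type u) [CommRing R] : Prop :=
  IsLocalRing R ∧ IsNoetherianRing R ∧ ∃ n : ℕ, HasInjectiveDimensionLE (ModuleCat.of R R) n

/-- `R` is generically Gorenstein if `R_p` is Gorenstein for every minimal prime `p`. -/
def IsGenericallyGorenstein (R : Type u) [CommRing R] : Prop :=
  ∀ (p : Ideal R) [p.IsPrime], p ∈ minimalPrimes R → IsGorensteinLocal (Localization.AtPrime p)

/-- The `R`-module `Ext^i_R(k, M)`, where `k` is the residue field of `R`. -/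
abbrev ExtResidueField (R : Type u) [CommRing R] [IsLocalRing R]
    (M : Type u) [AddCommGroup M] [Module R M] (i : ℕ) : Type u :=
  Abelian.Ext.{u} (ModuleCat.of R (ResidueField R)) (ModuleCat.of R M) i

open Classical in
/-- A finitely generated module `C` over a Cohen-Macaulay local ring `R` of dimension `d` is a
canonical module if `dim_k Ext^i_R(k, C)` is `1` for `i = d` and `0` for `i ≠ d` (equivalently, `C`
is maximal Cohen-Macaulay, of type one and of finite injective dimension). -/
structure IsCanonicalModule (R : Type u) [CommRing R] [IsLocalRing R]
    (C : Type u) [AddCommGroup C] [Module R C] : Prop where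
  finite : Module.Finite R C
  length_ext : ∀ i : ℕ, Module.length R (ExtResidueField R C i) =
    if (i : WithBot ℕ∞) = ringKrullDim R then 1 else 0

/-- `I` is `m`-primary: its radical is the maximal ideal. -/
def IsMaximalPrimary {R : Type u} [CommRing R] [IsLocalRing R] (I : Ideal R) : Prop :=
  I.radical = maximalIdeal R

/-- A canonical ideal (of a one-dimensional Cohen-Macaulay local ring): an `m`-primary ideal which
is a canonical module. -/
structure IsCanonicalIdeal {R : Type u} [CommRing R] [IsLocalRing R] (I : Ideal R) : Prop where
  primary : IsMaximalPrimary I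
  canonical : IsCanonicalModule R I

/-- `J` is a reduction of `I`: `J ⊆ I` and `J I^n = I^(n+1)` for some `n`. -/
def IsReductionOf {R : Type u} [CommRing R] (J I : Ideal R) : Prop :=
  J ≤ I ∧ ∃ n : ℕ, J * I ^ n = I ^ (n + 1)

/-- `e` is the Hilbert-Samuel multiplicity of `M` with respect to the `m`-primary ideal `I` of a
`d`-dimensional local ring: `e = lim d! * ℓ(M / I^n M) / n^d`. For finitely generated `M` the
lengths are finite, so that `ENat.toNat` loses nothing. -/
def IsMultiplicity {R : Type u} [CommRing R] (d : ℕ) (I : Ideal R)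
    (M : Type u) [AddCommGroup M] [Module R M] (e : ℝ) : Prop :=
  Tendsto (fun n : ℕ => (Nat.factorial d : ℝ) *
    ((Module.length R (M ⧸ (I ^ n • (⊤ : Submodule R M)))).toNat : ℝ) / (n : ℝ) ^ d)
    atTop (𝓝 e)

/-- Over a one-dimensional Cohen-Macaulay local ring, the nonzero finitely generated torsion-free
module `M` has minimal multiplicity with respect to the `m`-primary ideal `I` if
`e(I, M) = ℓ(IM / I²M)`. -/
structure HasMinimalMultiplicity {R : Type u} [CommRing R] [IsLocalRing R] (I : Ideal R)
    (M : Type u) [AddCommGroup M] [Module R M] : Prop where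
  primary : IsMaximalPrimary I
  finite : Module.Finite R M
  nontrivial : Nontrivial M
  torsionFree : Module.IsTorsionFree R M
  multiplicity_eq : IsMultiplicity 1 I M
    ((Module.length R ((I • ⊤ : Submodule R M) ⧸
      (I • ⊤ : Submodule R (I • ⊤ : Submodule R M)))).toNat : ℝ)

/-- `e₁` is the first Hilbert coefficient of the `m`-primary ideal `I` of a one-dimensional local
ring: `ℓ(R / I^(n+1)) = e₀ (n + 1) - e₁` for all large `n`, for some integer `e₀`. -/
def IsFirstHilbertCoeff {R : Type u} [CommRing R] (I : Ideal R) (e₁ : ℤ) : Prop :=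
  ∃ e₀ : ℤ, ∀ᶠ n : ℕ in atTop,
    ((Module.length R (R ⧸ I ^ (n + 1))).toNat : ℤ) = e₀ * ((n : ℤ) + 1) - e₁

/-- The Cohen-Macaulay type `r(R) = dim_k Ext^1_R(k, R)` of a one-dimensional Cohen-Macaulay local
ring. -/
def cohenMacaulayType (R : Type u) [CommRing R] [IsLocalRing R] : ℕ :=
  (Module.length R (ExtResidueField R R 1)).toNat

/-- A one-dimensional Cohen-Macaulay local ring `R` is almost Gorenstein if it has a canonical
ideal `I` with `e₁(I) ≤ r(R)`. -/
def IsAlmostGorenstein (R : Type u) [CommRing R] [IsLocalRing R] : Prop :=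
  ∃ (I : Ideal R) (e₁ : ℤ), IsCanonicalIdeal I ∧ IsFirstHilbertCoeff I e₁ ∧
    e₁ ≤ (cohenMacaulayType R : ℤ)

end

/-! Everything happens among `R`-submodules of the total quotient ring `Q`. A principal reduction
`a` of a canonical ideal `I` is a nonzerodivisor, so `K = a⁻¹I` makes sense; it contains `1`, its
powers become stationary, and `K : K = R` because `K` is canonical. Each of the three conditions
turns out to say that `K m ⊆ R`. For a regular fractional ideal `X`, the multiplicity of `X` is
`ℓ(X/aX) = ℓ(IX/aIX)`. Since `aIX ⊆ I²X ⊆ IX`, minimal multiplicity means `I²X = aIX`, that is,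
`K·KX = KX` (`hasMinimalMultiplicity_iff`). Then `K : KX = R : X` is stable under `K`; with `X = m`
or `X = R : m ≅ m*` this yields `K m ⊆ R`. Conversely, nonregularity gives `(R : m)m ⊆ m`, so `K ⊆ R
: m` implies stability. For almost Gorensteinness, `e₁(I) = ℓ(Kⁿ/R)` for large `n`
(`isFirstHilbertCoeff_iff`), while the type is `ℓ((R : m)/R) = ℓ(K/mK)` by canonical duality;
`relLength_pow_le_iff` compares the two. Duality is proved by hand from the one fact `ℓ((W : m)/W) ≤
1`. It also shows that any two canonical ideals differ by a unit of `Q`, so that one `K` serves for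
both. -/

/-! ### Lengths of subquotients. -/

section RelativeLength

variable {R M N : Type*} [CommRing R] [AddCommGroup M] [Module R M] [AddCommGroup N] [Module R N]

/-- The length of `X / (X ⊓ Y)`. -/
noncomputable def relLength (Y X : Submodule R M) : ℕ∞ :=
  Module.length R (X ⧸ Y.submoduleOf X)

theorem relLength_eq_zero_iff {Y X : Submodule R M} : relLength Y X = 0 ↔ X ≤ Y := by
  rw [relLength, Module.length_eq_zero_iff, Submodule.Quotient.subsingleton_iff,
    Submodule.submoduleOf_eq_top]

theorem relLength_le_of_map {Y X : Submodule R M} {V Z : Submodule R N} (f : M →ₗ[R] N)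
    (hX : ∀ x ∈ X, f x ∈ Z) (hY : ∀ x ∈ X, f x ∈ V ↔ x ∈ Y) :
    relLength Y X ≤ relLength V Z := by
  have hle : Y.submoduleOf X ≤ (V.submoduleOf Z).comap (f.restrict hX) :=
    fun x hx => (hY x x.2).2 hx
  refine Module.length_le_of_injective (Submodule.mapQ _ _ (f.restrict hX) hle) ?_
  rw [injective_iff_map_eq_zero]
  intro q
  induction q using Submodule.Quotient.induction_on with
  | H x =>
    intro h
    rw [Submodule.mapQ_apply, Submodule.Quotient.mk_eq_zero] at h
    rw [Submodule.Quotient.mk_eq_zero]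
    exact (hY x x.2).1 h

theorem relLength_eq_length {P : Type*} [AddCommGroup P] [Module R P] {Y X : Submodule R M}
    (g : X →ₗ[R] P) (hg : Function.Surjective g) (hk : ∀ x : X, g x = 0 ↔ (x : M) ∈ Y) :
    relLength Y X = Module.length R P := by
  have h : Y.submoduleOf X = LinearMap.ker g := by
    ext x
    exact (hk x).symm
  rw [relLength, h]
  exact (g.quotKerEquivOfSurjective hg).length_eq

theorem relLength_eq_of_map {Y X : Submodule R M} {V Z : Submodule R N} (f : M →ₗ[R] N)
    (hX : ∀ x ∈ X, f x ∈ Z) (hY : ∀ x ∈ X, f x ∈ V ↔ x ∈ Y)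
    (hZ : ∀ z ∈ Z, ∃ x ∈ X, z - f x ∈ V) :
    relLength Y X = relLength V Z := by
  refine relLength_eq_length ((V.submoduleOf Z).mkQ ∘ₗ f.restrict hX) ?_ ?_
  · intro q
    induction q using Submodule.Quotient.induction_on with
    | H z =>
      obtain ⟨x, hx, h⟩ := hZ z z.2
      refine ⟨⟨x, hx⟩, ?_⟩
      symm
      exact (Submodule.Quotient.eq _).2 h
  · intro x
    exact (Submodule.Quotient.mk_eq_zero _).trans (hY x x.2)

theorem relLength_add {Y Z X : Submodule R M} (hYZ : Y ≤ Z) (hZX : Z ≤ X) :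
    relLength Y X = relLength Y Z + relLength Z X := by
  have h₁ : Y.submoduleOf Z ≤ (Y.submoduleOf X).comap (Submodule.inclusion hZX) :=
    fun x hx => hx
  have h₂ : Y.submoduleOf X ≤ (Z.submoduleOf X).comap LinearMap.id := fun x hx => hYZ hx
  refine Module.length_eq_add_of_exact (Submodule.mapQ _ _ _ h₁) (Submodule.mapQ _ _ _ h₂)
    ?_ ?_ ?_
  · rw [injective_iff_map_eq_zero]
    intro q
    induction q using Submodule.Quotient.induction_on with
    | H x =>
      intro h
      rw [Submodule.mapQ_apply, Submodule.Quotient.mk_eq_zero] at h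
      rw [Submodule.Quotient.mk_eq_zero]
      exact h
  · intro q
    induction q using Submodule.Quotient.induction_on with
    | H x => exact ⟨Submodule.Quotient.mk x, rfl⟩
  · intro q
    induction q using Submodule.Quotient.induction_on with
    | H x =>
      rw [Submodule.mapQ_apply, Submodule.Quotient.mk_eq_zero]
      constructor
      · intro h
        exact ⟨Submodule.Quotient.mk ⟨x, h⟩, rfl⟩
      · rintro ⟨q, hq⟩
        induction q using Submodule.Quotient.induction_on with
        | H z =>
          rw [Submodule.mapQ_apply, Submodule.Quotient.eq] at hq
          have h1 : (z : M) - x ∈ Y := hq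
          have := Z.sub_mem z.2 (hYZ h1)
          rwa [sub_sub_cancel] at this

theorem relLength_sup_right (Y X : Submodule R M) :
    relLength Y (Y ⊔ X) = relLength (Y ⊓ X) X := by
  symm
  refine relLength_eq_of_map LinearMap.id (fun x hx => le_sup_right (a := Y) hx)
    (fun x hx => by simp [hx]) fun z hz => ?_
  obtain ⟨y, hy, x, hx, rfl⟩ := Submodule.mem_sup.1 hz
  exact ⟨x, hx, by simpa using hy⟩

theorem relLength_antitone_left {Y Y' X : Submodule R M} (h : Y ≤ Y') (h' : Y' ≤ X) :
    relLength Y' X ≤ relLength Y X := by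
  rw [relLength_add h h']
  exact le_add_self

theorem relLength_mono_right {Y X X' : Submodule R M} (h : Y ≤ X) (h' : X ≤ X') :
    relLength Y X ≤ relLength Y X' := by
  rw [relLength_add h h']
  exact le_self_add

theorem relLength_map {f : M →ₗ[R] N} (hf : Function.Injective f) (Y X : Submodule R M) :
    relLength (Y.map f) (X.map f) = relLength Y X := by
  symm
  refine relLength_eq_of_map f (fun x hx => ⟨x, hx, rfl⟩)
    (fun x _ => Function.Injective.mem_set_image hf) ?_
  rintro _ ⟨x, hx, rfl⟩
  exact ⟨x, hx, by simp⟩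

theorem relLength_top (Y : Submodule R M) : relLength Y ⊤ = Module.length R (M ⧸ Y) :=
  relLength_eq_length (Y.mkQ ∘ₗ (⊤ : Submodule R M).subtype)
    (fun q => by
      obtain ⟨x, rfl⟩ := Y.mkQ_surjective q
      exact ⟨⟨x, trivial⟩, rfl⟩)
    fun x => Submodule.Quotient.mk_eq_zero _

theorem length_quotient_eq_relLength {f : M →ₗ[R] N} (hf : Function.Injective f)
    (Y : Submodule R M) :
    Module.length R (M ⧸ Y) = relLength (Y.map f) (LinearMap.range f) := by
  rw [← relLength_top, ← relLength_map hf, Submodule.map_top]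

end RelativeLength

/-! ### Multiplication by units of `Q`, and colon submodules. -/

section Scaling

variable {R Q : Type*} [CommRing R] [CommRing Q] [Algebra R Q]

open Submodule

theorem span_unit_mul_span_inv (u : Qˣ) :
    (span R {(u : Q)}) * (span R {((u⁻¹ : Qˣ) : Q)}) = 1 := by
  rw [span_mul_span, Set.singleton_mul_singleton, Units.mul_inv, one_eq_span]

theorem span_inv_mul_span_unit (u : Qˣ) :
    (span R {((u⁻¹ : Qˣ) : Q)}) * (span R {(u : Q)}) = 1 := by
  rw [mul_comm, span_unit_mul_span_inv]

theorem span_unit_mul_le_iff (u : Qˣ) {X Y : Submodule R Q} :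
    span R {(u : Q)} * X ≤ Y ↔ X ≤ span R {((u⁻¹ : Qˣ) : Q)} * Y := by
  constructor
  · intro h
    have := mul_le_mul_right h (span R {((u⁻¹ : Qˣ) : Q)})
    rwa [← mul_assoc, span_inv_mul_span_unit, one_mul] at this
  · intro h
    have := mul_le_mul_right h (span R {(u : Q)})
    rwa [← mul_assoc, span_unit_mul_span_inv, one_mul] at this

theorem relLength_span_unit_mul (u : Qˣ) (Y X : Submodule R Q) :
    relLength (span R {(u : Q)} * Y) (span R {(u : Q)} * X) = relLength Y X := by
  have h (Z : Submodule R Q) : span R {(u : Q)} * Z = Z.map (LinearMap.mulLeft R (u : Q)) := by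
    ext z
    simp [mem_span_singleton_mul]
  rw [h, h]
  exact relLength_map (fun x y hxy => u.isUnit.mul_left_cancel hxy) Y X

theorem div_span_unit_mul (W X : Submodule R Q) (u : Qˣ) :
    W / (span R {(u : Q)} * X) = span R {((u⁻¹ : Qˣ) : Q)} * (W / X) := by
  apply le_antisymm
  · rw [← inv_inv u, ← span_unit_mul_le_iff, inv_inv, Submodule.le_div_iff_mul_le, mul_assoc,
      mul_left_comm]
    exact Submodule.le_div_iff_mul_le.1 le_rfl
  · rw [Submodule.le_div_iff_mul_le, mul_mul_mul_comm, span_inv_mul_span_unit, one_mul]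
    exact Submodule.le_div_iff_mul_le.1 le_rfl

theorem div_mono_left {W W' X : Submodule R Q} (h : W ≤ W') : W / X ≤ W' / X :=
  fun _ hx y hy => h (hx y hy)

theorem div_anti_right {W X X' : Submodule R Q} (h : X ≤ X') : W / X' ≤ W / X :=
  fun _ hx y hy => hx y (h hy)

theorem div_one_eq (W : Submodule R Q) : W / 1 = W := by
  apply le_antisymm
  · intro x hx
    simpa using hx 1 (one_le.1 le_rfl)
  · rw [Submodule.le_div_iff_mul_le, mul_one]

theorem div_mul_eq (W X Y : Submodule R Q) : W / (X * Y) = (W / X) / Y :=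
  eq_of_forall_le_iff fun Z => by
    simp only [Submodule.le_div_iff_mul_le, mul_assoc, mul_comm Y X]

theorem div_mul_le (W X : Submodule R Q) : (W / X) * X ≤ W :=
  Submodule.le_div_iff_mul_le.1 le_rfl

end Scaling

/-! ### Regular fractional ideals and finiteness of lengths. -/

section Fractional

variable {R Q : Type*} [CommRing R] [CommRing Q] [Algebra R Q]

open Submodule

/-- A finitely generated submodule of `Q` which contains a unit of `Q`. -/
structure IsRegFrac (X : Submodule R Q) : Prop where
  fg : X.FG
  exists_unit : ∃ u : Qˣ, (u : Q) ∈ X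

theorem isRegFrac_one : IsRegFrac (1 : Submodule R Q) :=
  ⟨by rw [one_eq_span]; exact fg_span_singleton 1, 1, one_le.1 le_rfl⟩

theorem IsRegFrac.mul {X Y : Submodule R Q} (hX : IsRegFrac X) (hY : IsRegFrac Y) :
    IsRegFrac (X * Y) := by
  obtain ⟨u, hu⟩ := hX.2
  obtain ⟨v, hv⟩ := hY.2
  exact ⟨hX.1.mul hY.1, u * v, by simpa using mul_mem_mul hu hv⟩

theorem isRegFrac_span_unit (u : Qˣ) : IsRegFrac (span R {(u : Q)}) :=
  ⟨fg_span_singleton _, u, mem_span_singleton_self _⟩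

theorem IsRegFrac.pow {X : Submodule R Q} (hX : IsRegFrac X) (n : ℕ) : IsRegFrac (X ^ n) := by
  induction n with
  | zero => simpa using isRegFrac_one
  | succ n ih => rw [pow_succ]; exact ih.mul hX

variable [IsFractionRing R Q]

/-- Common denominators: the numerator `p` of the unit in `Y` is a nonzerodivisor lying in `Y`, and
`p` times a denominator of `x` carries `x` into `R p ⊆ Y`. -/
theorem exists_nonZeroDivisors_smul_mem {X Y : Submodule R Q} (hX : X.FG)
    (hY : ∃ u : Qˣ, (u : Q) ∈ Y) : ∃ b ∈ nonZeroDivisors R, ∀ x ∈ X, b • x ∈ Y := by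
  obtain ⟨u, hu⟩ := hY
  obtain ⟨⟨p, q⟩, hpq⟩ := IsLocalization.surj (nonZeroDivisors R) (u : Q)
  have hpY : algebraMap R Q p ∈ Y := by
    rw [← hpq, mul_comm, ← Algebra.smul_def]
    exact Y.smul_mem _ hu
  have hp : p ∈ nonZeroDivisors R := by
    have hunit : IsUnit (algebraMap R Q p) := by
      rw [← hpq]
      exact u.isUnit.mul (IsLocalization.map_units Q q)
    rw [mem_nonZeroDivisors_iff_right]
    intro z hz
    apply IsFractionRing.injective R Q
    rw [map_zero]
    apply hunit.mul_right_cancel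
    rw [← map_mul, hz, map_zero, zero_mul]
  induction X, hX using Submodule.fg_induction with
  | singleton x =>
    obtain ⟨⟨r, s⟩, hrs⟩ := IsLocalization.surj (nonZeroDivisors R) x
    refine ⟨p * s, mul_mem hp s.2, fun y hy => ?_⟩
    obtain ⟨c, rfl⟩ := mem_span_singleton.1 hy
    have h : (p * (s : R)) • c • x = (c * r) • algebraMap R Q p := by
      simp only [Algebra.smul_def, map_mul]
      linear_combination (algebraMap R Q p) * (algebraMap R Q c) * hrs
    rw [h]
    exact Y.smul_mem _ hpY
  | sup X₁ X₂ _ _ h₁ h₂ =>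
    obtain ⟨b₁, hb₁, h₁⟩ := h₁
    obtain ⟨b₂, hb₂, h₂⟩ := h₂
    refine ⟨b₁ * b₂, mul_mem hb₁ hb₂, fun x hx => ?_⟩
    obtain ⟨x₁, hx₁, x₂, hx₂, rfl⟩ := mem_sup.1 hx
    rw [smul_add]
    refine add_mem ?_ ?_
    · rw [mul_comm, mul_smul]
      exact Y.smul_mem _ (h₁ _ hx₁)
    · rw [mul_smul]
      exact Y.smul_mem _ (h₂ _ hx₂)

theorem exists_unit_span_mul_le {X Y : Submodule R Q} (hX : X.FG)
    (hY : ∃ u : Qˣ, (u : Q) ∈ Y) : ∃ u : Qˣ, span R {(u : Q)} * X ≤ Y := by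
  obtain ⟨b, hb, h⟩ := exists_nonZeroDivisors_smul_mem hX hY
  refine ⟨(IsLocalization.map_units Q (⟨b, hb⟩ : nonZeroDivisors R)).unit, ?_⟩
  intro z hz
  obtain ⟨x, hx, rfl⟩ := mem_span_singleton_mul.1 hz
  simpa [Algebra.smul_def] using h x hx

theorem IsRegFrac.div [IsNoetherianRing R] {W X : Submodule R Q} (hW : IsRegFrac W)
    (hX : IsRegFrac X) : IsRegFrac (W / X) := by
  constructor
  · obtain ⟨u, hu⟩ := hX.2
    have h : W / X ≤ span R {((u⁻¹ : Qˣ) : Q)} * W := by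
      intro x hx
      exact mem_span_singleton_mul.2 ⟨x * u, hx _ hu, by rw [mul_comm, mul_assoc]; simp⟩
    have h2 : (span R {((u⁻¹ : Qˣ) : Q)} * W).FG := (fg_span_singleton _).mul hW.1
    have := isNoetherian_of_fg_of_noetherian _ h2
    exact (isNoetherian_submodule.1 this) _ h
  · obtain ⟨u, hu⟩ := exists_unit_span_mul_le hX.1 hW.2
    exact ⟨u, fun x hx => hu (mul_mem_mul (mem_span_singleton_self _) hx)⟩

/-- The quotient is finitely generated and killed by a nonzerodivisor `b`, hence is a finite module
over the Artinian ring `R/b`. -/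
theorem relLength_ne_top [IsNoetherianRing R]
    (hfin : ∀ b ∈ nonZeroDivisors R, IsArtinianRing (R ⧸ Ideal.span {b}))
    {X Y : Submodule R Q} (hX : X.FG) (hY : ∃ u : Qˣ, (u : Q) ∈ Y) : relLength Y X ≠ ⊤ := by
  obtain ⟨b, hb, h⟩ := exists_nonZeroDivisors_smul_mem hX hY
  have := hfin b hb
  have : Module.Finite R X := Module.Finite.iff_fg.2 hX
  have ht : Module.IsTorsionBySet R (X ⧸ Y.submoduleOf X) (Ideal.span {b} : Ideal R) := by
    rw [Module.isTorsionBySet_span_singleton_iff]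
    intro q
    induction q using Submodule.Quotient.induction_on with
    | H x =>
      rw [← Submodule.Quotient.mk_smul, Submodule.Quotient.mk_eq_zero]
      exact h x x.2
  let := ht.module
  have := ht.isScalarTower (S := R)
  have : Module.Finite (R ⧸ Ideal.span {b}) (X ⧸ Y.submoduleOf X) :=
    Module.Finite.of_restrictScalars_finite R _ _
  rw [relLength, Module.length_eq_of_surjective (R := R ⧸ Ideal.span {b})
    Ideal.Quotient.mk_surjective]
  exact Module.length_ne_top

end Fractional

/-! ### Duality into a fractional ideal of type one. -/

section Duality

variable {R Q : Type*} [CommRing R] [IsLocalRing R] [IsNoetherianRing R]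
  [CommRing Q] [Algebra R Q]

open Submodule IsLocalization

-- Peels one simple factor off the top of `X/Y`: `Z` is a maximal submodule containing `Y`. By
-- Nakayama `t • z ∈ Z` for `t ∈ m`, since otherwise `X = Z + mX`.
omit [IsNoetherianRing R] in
theorem exists_relLength_eq_one {M : Type*} [AddCommGroup M] [Module R M] {X Y : Submodule R M}
    (hX : X.FG) (hYX : Y ≤ X) (hne : ¬ X ≤ Y) :
    ∃ Z : Submodule R M, ∃ z ∈ X, Y ≤ Z ∧ Z ≤ X ∧ relLength Z X = 1 ∧ X ≤ Z ⊔ span R {z} ∧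
      ∀ t ∈ maximalIdeal R, t • z ∈ Z := by
  have : Module.Finite R X := Module.Finite.iff_fg.2 hX
  obtain h | ⟨C, hC, hYC⟩ := eq_top_or_exists_le_coatom (Y.submoduleOf X)
  · exact absurd (submoduleOf_eq_top.1 h) hne
  have hmem (x : X) : (x : M) ∈ C.map X.subtype ↔ x ∈ C :=
    Function.Injective.mem_set_image X.injective_subtype
  have hZX : C.map X.subtype ≤ X := map_subtype_le X C
  obtain ⟨z, hz⟩ : ∃ z, z ∉ C := by
    by_contra! h
    exact hC.1 (eq_top_iff.2 fun x _ => h x)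
  refine ⟨C.map X.subtype, z, z.2, ?_, hZX, ?_, ?_, ?_⟩
  · exact fun y hy => (hmem ⟨y, hYX hy⟩).2 (hYC hy)
  · rw [relLength_eq_length C.mkQ C.mkQ_surjective fun x => by
      rw [hmem, mkQ_apply, Quotient.mk_eq_zero], Module.length_eq_one_iff]
    exact isSimpleModule_iff_isCoatom.2 hC
  · have h : C ⊔ span R {z} = ⊤ := hC.2 _ (left_lt_sup.2 fun h => hz (h (mem_span_singleton_self z)))
    have h2 := congrArg (Submodule.map X.subtype) h
    rw [Submodule.map_sup, map_span, Set.image_singleton, Submodule.map_top, range_subtype] at h2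
    exact h2.ge
  · intro t ht
    rw [← coe_smul, hmem]
    by_contra h
    have h1 : C ⊔ span R {t • z} = ⊤ :=
      hC.2 _ (left_lt_sup.2 fun h' => h (h' (mem_span_singleton_self _)))
    have h2 : (⊤ : Submodule R X) ≤ C := by
      refine le_of_le_smul_of_le_jacobson_bot (I := maximalIdeal R) Module.Finite.fg_top
        (maximalIdeal_le_jacobson _) ?_
      rw [← h1]
      refine sup_le_sup_left ?_ _
      rw [span_singleton_le_iff_mem, h1]
      exact smul_mem_smul ht trivial
    exact hC.1 (top_le_iff.1 h2)

/-- If `W` has type at most one, then dualizing into `W` does not increase relative lengths. -/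
theorem relLength_div_le {W : Submodule R Q}
    (hW : relLength W (W / coeSubmodule Q (maximalIdeal R)) ≤ 1) {X Y : Submodule R Q}
    (hX : X.FG) (hYX : Y ≤ X) : relLength (W / X) (W / Y) ≤ relLength Y X := by
  by_cases htop : relLength Y X = ⊤
  · simp [htop]
  obtain ⟨n, hn⟩ := ENat.ne_top_iff_exists.1 htop
  have : IsNoetherian R X := isNoetherian_of_fg_of_noetherian X hX
  induction n generalizing X with
  | zero =>
    have h : X ≤ Y := relLength_eq_zero_iff.1 hn.symm
    rw [relLength_eq_zero_iff.2 (div_anti_right h)]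
    exact zero_le
  | succ n ih =>
    have hne : ¬ X ≤ Y := by
      rw [← relLength_eq_zero_iff, ← hn]
      simp
    obtain ⟨Z, z, hz, hYZ, hZX, hlen, hsup, hmz⟩ := exists_relLength_eq_one hX hYX hne
    have hsum := relLength_add hYZ hZX
    have hZn : relLength Y Z = n := by
      rw [← hn, hlen] at hsum
      have h2 : relLength Y Z ≠ ⊤ := by
        intro h
        rw [h] at hsum
        exact absurd hsum (by simp)
      lift relLength Y Z to ℕ using h2 with m
      norm_cast at hsum ⊢
      omega
    have hZfg : Z.FG := isNoetherian_submodule.1 this Z hZX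
    have hZ := ih hZfg hYZ (by simp [hZn]) hZn.symm (isNoetherian_of_fg_of_noetherian Z hZfg)
    -- Multiplication by `z` embeds `(W : Z)/(W : X)` into `(W : m)/W`, because `m z ⊆ Z` and `X = Z
    -- + R z`.
    have hstep : relLength (W / X) (W / Z) ≤ relLength W (W / coeSubmodule Q (maximalIdeal R)) := by
      refine relLength_le_of_map (LinearMap.mulRight R z) ?_ ?_
      · rintro w hw _ ⟨t, ht, rfl⟩
        have := hw _ (hmz t ht)
        rw [mul_smul_comm, Algebra.smul_def, mul_left_comm, mul_comm, mul_assoc] at this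
        simpa [mul_assoc, mul_comm, mul_left_comm] using this
      · intro w hw
        refine ⟨fun h x hx => ?_, fun h => h z hz⟩
        obtain ⟨y, hy, c, hc, rfl⟩ := mem_sup.1 (hsup hx)
        obtain ⟨r, rfl⟩ := mem_span_singleton.1 hc
        rw [mul_add, mul_smul_comm]
        exact add_mem (hw y hy) (W.smul_mem r h)
    rw [relLength_add (div_anti_right hZX) (div_anti_right hYZ), hsum, add_comm, hlen]
    exact add_le_add hZ (hstep.trans hW)

variable [IsFractionRing R Q]
  (hfin : ∀ b ∈ nonZeroDivisors R, IsArtinianRing (R ⧸ Ideal.span {b}))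

include hfin

-- Rescale `X'` to `Y ⊆ X` and compute `ℓ(X/uY)` along `uY ⊆ uX ⊆ X` and along `uY ⊆ Y ⊆ X`; the
-- term `ℓ(uX/uY) = ℓ(X/Y)` is finite and cancels.
omit [IsLocalRing R] in
theorem relLength_span_unit_mul_self (u : Qˣ) {X X' : Submodule R Q} (hX : IsRegFrac X)
    (hX' : IsRegFrac X') (h : span R {(u : Q)} * X ≤ X) (h' : span R {(u : Q)} * X' ≤ X') :
    relLength (span R {(u : Q)} * X) X = relLength (span R {(u : Q)} * X') X' := by
  obtain ⟨v, hv⟩ := exists_unit_span_mul_le hX'.1 hX.2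
  set s := span R {(u : Q)}
  set Y := span R {(v : Q)} * X'
  have hsY : s * Y = span R {(v : Q)} * (s * X') := mul_left_comm _ _ _
  have hY : s * Y ≤ Y := by
    rw [hsY]
    exact mul_le_mul_right h' _
  have hYreg : IsRegFrac Y := (isRegFrac_span_unit v).mul hX'
  have h₁ := relLength_add (mul_le_mul_right hv s) h
  have h₂ := relLength_add hY hv
  rw [relLength_span_unit_mul] at h₁
  have h₃ : relLength (s * Y) Y = relLength (s * X') X' := by
    rw [hsY, relLength_span_unit_mul]
  rw [h₂, h₃, add_comm] at h₁
  exact (ENat.add_right_injective_of_ne_top (relLength_ne_top hfin hX.1 hYreg.2) h₁).symm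

/-- Choose `uX ⊆ Y ⊆ X`. Dualizing preserves the total length `ℓ(X/uX)`, by independence of the
module, and increases neither of the two pieces, so it preserves both. -/
theorem relLength_div_eq {W : Submodule R Q} (hWreg : IsRegFrac W)
    (hW : relLength W (W / coeSubmodule Q (maximalIdeal R)) ≤ 1) {X Y : Submodule R Q}
    (hX : IsRegFrac X) (hY : IsRegFrac Y) (hYX : Y ≤ X) :
    relLength (W / X) (W / Y) = relLength Y X := by
  obtain ⟨u, hu⟩ := exists_unit_span_mul_le hX.1 hY.2
  set s := span R {(u : Q)} with hs
  have hXX : s * X ≤ X := hu.trans hYX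
  have hWX : IsRegFrac (W / X) := hWreg.div hX
  have hsX : IsRegFrac (s * X) := (isRegFrac_span_unit u).mul hX
  have hsW : s * (W / X) ≤ W / X := by
    rw [Submodule.le_div_iff_mul_le, mul_right_comm, mul_comm, ← Submodule.le_div_iff_mul_le]
    exact div_anti_right hXX
  have key : relLength (W / X) (W / (s * X)) = relLength (s * X) X := by
    rw [relLength_span_unit_mul_self hfin u hX hWX hXX hsW, div_span_unit_mul,
      ← relLength_span_unit_mul u, ← mul_assoc, span_unit_mul_span_inv, one_mul]
  rw [relLength_add hu hYX, relLength_add (div_anti_right hYX) (div_anti_right hu)] at key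
  have h₁ := relLength_div_le hW hX.1 hYX
  have h₂ := relLength_div_le hW hY.1 hu
  have f₁ := relLength_ne_top hfin hX.1 hY.2
  have f₂ := relLength_ne_top hfin hY.1 hsX.2
  have f₃ := ne_top_of_le_ne_top f₁ h₁
  have f₄ := ne_top_of_le_ne_top f₂ h₂
  generalize relLength (W / X) (W / Y) = a at *
  generalize relLength (W / Y) (W / (s * X)) = b at *
  generalize relLength Y X = c at *
  generalize relLength (s * X) Y = d at *
  lift a to ℕ using f₃
  lift b to ℕ using f₄
  lift c to ℕ using f₁
  lift d to ℕ using f₂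
  norm_cast at *
  omega

/-- Every regular fractional ideal is reflexive with respect to one of type one. -/
theorem div_div_eq {W : Submodule R Q} (hWreg : IsRegFrac W)
    (hW : relLength W (W / coeSubmodule Q (maximalIdeal R)) ≤ 1) {X : Submodule R Q}
    (hX : IsRegFrac X) : W / (W / X) = X := by
  have hle : X ≤ W / (W / X) := by
    rw [Submodule.le_div_iff_mul_le, mul_comm]
    exact div_mul_le W X
  have hWX := hWreg.div hX
  -- A triple dual is a single dual, so the length of the bidual over `X` equals that of a zero
  -- quotient.
  have h3 : W / (W / (W / X)) = W / X := by
    apply le_antisymm (div_anti_right hle)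
    rw [Submodule.le_div_iff_mul_le, mul_comm]
    exact div_mul_le W _
  have h := relLength_div_eq hfin hWreg hW (hWreg.div hWX) hX hle
  rw [h3, relLength_eq_zero_iff.2 le_rfl] at h
  exact le_antisymm (relLength_eq_zero_iff.1 h.symm) hle

theorem div_self_eq_one {W : Submodule R Q} (hWreg : IsRegFrac W)
    (hW : relLength W (W / coeSubmodule Q (maximalIdeal R)) ≤ 1) : W / W = 1 := by
  simpa only [div_one_eq] using div_div_eq hfin hWreg hW isRegFrac_one

/-- Two regular fractional ideals of type one differ by a unit of the total quotient ring. -/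
theorem exists_unit_eq_span_mul {I W : Submodule R Q} (hIreg : IsRegFrac I)
    (hI : relLength I (I / coeSubmodule Q (maximalIdeal R)) ≤ 1) (hWreg : IsRegFrac W)
    (hW : relLength W (W / coeSubmodule Q (maximalIdeal R)) ≤ 1) :
    ∃ u : Qˣ, W = span R {(u : Q)} * I := by
  -- The `B`-dual of `(B : A)A` is `(B : (B : A)) : A = A : A = R`; dualizing back gives `B`. Hence
  -- `W : I` and `I : W` behave as mutually inverse ideals.
  have prod {A B : Submodule R Q} (hA : IsRegFrac A)
      (hAt : relLength A (A / coeSubmodule Q (maximalIdeal R)) ≤ 1) (hB : IsRegFrac B)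
      (hBt : relLength B (B / coeSubmodule Q (maximalIdeal R)) ≤ 1) : (B / A) * A = B := by
    have h : B / ((B / A) * A) = 1 := by
      rw [div_mul_eq, div_div_eq hfin hB hBt hA, div_self_eq_one hfin hA hAt]
    rw [← div_div_eq hfin hB hBt ((hB.div hA).mul hA), h, div_one_eq]
  have hW' := prod hIreg hI hWreg hW
  have hI' := prod hWreg hW hIreg hI
  set J := W / I
  set J' := I / W
  have hJJ : J' * J ≤ 1 := by
    rw [← div_self_eq_one hfin hIreg hI, Submodule.le_div_iff_mul_le, mul_assoc, hW', hI']
  -- If `J'J ⊆ m`, then `I = J'J I ⊆ mI` and Nakayama kills `I`. So some product `j'j` is a unit of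
  -- `R`, and `j` is the required scaling factor.
  obtain ⟨j', hj', j, hj, hjj⟩ : ∃ j' ∈ J', ∃ j ∈ J,
      j' * j ∉ coeSubmodule Q (maximalIdeal R) := by
    by_contra! h
    have hle : J' * J ≤ coeSubmodule Q (maximalIdeal R) := Submodule.mul_le.2 h
    have h2 : I ≤ maximalIdeal R • I := by
      conv_lhs => rw [← hI', ← hW', ← mul_assoc]
      refine Submodule.mul_le.2 fun x hx y hy => ?_
      obtain ⟨t, ht, rfl⟩ := hle hx
      rw [Algebra.linearMap_apply, ← Algebra.smul_def]
      exact smul_mem_smul ht hy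
    have h3 : I = ⊥ :=
      eq_bot_of_le_smul_of_le_jacobson_bot _ _ hIreg.1 h2 (maximalIdeal_le_jacobson _)
    obtain ⟨u, hu⟩ := hIreg.2
    have hu0 : (u : Q) = 0 := by simpa [h3] using hu
    have : Nontrivial Q := (IsFractionRing.injective R Q).nontrivial
    exact u.ne_zero hu0
  obtain ⟨r, hr⟩ := mem_one.1 (hJJ (mul_mem_mul hj' hj))
  have hru : IsUnit r := by
    by_contra hn
    exact hjj ⟨r, (mem_maximalIdeal r).2 hn, hr⟩
  have hju : IsUnit j := isUnit_of_mul_isUnit_right (x := j') (hr ▸ hru.map (algebraMap R Q))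
  refine ⟨hju.unit, le_antisymm ?_ ?_⟩
  · intro w hw
    obtain ⟨s, hs⟩ := hru
    refine mem_span_singleton_mul.2 ⟨(↑s⁻¹ : R) • (j' * w), ?_, ?_⟩
    · refine I.smul_mem _ ?_
      rw [← hI']
      exact mul_mem_mul hj' hw
    · rw [IsUnit.unit_spec, mul_smul_comm, ← mul_assoc, mul_comm j j', ← hr, ← hs,
        ← Algebra.smul_def, smul_smul, Units.inv_mul, one_smul]
  · rw [← hW']
    refine mul_le_mul_left ?_ _
    simpa using hj

end Duality

/-! ### Homomorphisms out of an ideal as colon submodules. -/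

section HomDiv

variable {R Q : Type*} [CommRing R] [CommRing Q] [Algebra R Q] [IsFractionRing R Q]

open Submodule IsLocalization

/-- Multiplication by elements of `Y / J` as homomorphisms `J → M`, when `f` identifies `M`
with `Y`. -/
noncomputable def divToHom {M : Type*} [AddCommGroup M] [Module R M] (f : M →ₗ[R] Q)
    (hf : Function.Injective f) (J : Ideal R) :
    ↥(LinearMap.range f / coeSubmodule Q J) →ₗ[R] (J →ₗ[R] M) where
  toFun z :=
    (LinearEquiv.ofInjective f hf).symm.toLinearMap ∘ₗ
      LinearMap.codRestrict (LinearMap.range f)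
        ((LinearMap.mulLeft R (z : Q)) ∘ₗ Algebra.linearMap R Q ∘ₗ J.subtype)
        fun t => z.2 _ ⟨t, t.2, rfl⟩
  map_add' z w := by
    ext t
    apply (LinearEquiv.ofInjective f hf).injective
    ext
    simp only [map_add, Submodule.coe_add, LinearMap.add_apply, LinearEquiv.coe_coe,
      LinearMap.comp_apply, LinearEquiv.apply_symm_apply]
    exact add_mul (z : Q) w (algebraMap R Q t)
  map_smul' r z := by
    ext t
    apply (LinearEquiv.ofInjective f hf).injective
    ext
    simp only [map_smul, Submodule.coe_smul, LinearMap.smul_apply, LinearEquiv.coe_coe,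
      LinearMap.comp_apply, LinearEquiv.apply_symm_apply, RingHom.id_apply]
    exact smul_mul_assoc r (z : Q) (algebraMap R Q t)

omit [IsFractionRing R Q] in
theorem apply_divToHom {M : Type*} [AddCommGroup M] [Module R M] (f : M →ₗ[R] Q)
    (hf : Function.Injective f) (J : Ideal R) (z : ↥(LinearMap.range f / coeSubmodule Q J))
    (t : J) : f (divToHom f hf J z t) = z * algebraMap R Q t :=
  congrArg Subtype.val ((LinearEquiv.ofInjective f hf).apply_symm_apply
    ⟨z * algebraMap R Q t, z.2 _ ⟨t, t.2, rfl⟩⟩)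

omit [IsFractionRing R Q] in
theorem mul_eq_mul_of_mem_ideal {M : Type*} [AddCommGroup M] [Module R M] (f : M →ₗ[R] Q)
    {J : Ideal R} (φ : J →ₗ[R] M) (s t : J) :
    algebraMap R Q s * f (φ t) = algebraMap R Q t * f (φ s) := by
  rw [← Algebra.smul_def, ← Algebra.smul_def, ← map_smul, ← map_smul, ← map_smul, ← map_smul]
  congr 2
  ext
  simp [mul_comm]

/-- For a nonzerodivisor `x ∈ J`, a homomorphism `φ` is multiplication by `φ(x)/x`, since `x φ(t) =
t φ(x)`. -/
theorem divToHom_bijective {M : Type*} [AddCommGroup M] [Module R M] (f : M →ₗ[R] Q)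
    (hf : Function.Injective f) (J : Ideal R) (hJ : ∃ x ∈ nonZeroDivisors R, x ∈ J) :
    Function.Bijective (divToHom f hf J) := by
  obtain ⟨x, hx, hxJ⟩ := hJ
  have hu : IsUnit (algebraMap R Q x) := map_units Q (⟨x, hx⟩ : nonZeroDivisors R)
  constructor
  · intro z w h
    have := congrArg (fun φ => f (φ ⟨x, hxJ⟩)) h
    simp only [apply_divToHom] at this
    exact Subtype.ext (hu.mul_right_cancel this)
  · intro φ
    obtain ⟨u, hu⟩ := hu
    have key (t : J) : ((u⁻¹ : Qˣ) : Q) * f (φ ⟨x, hxJ⟩) * algebraMap R Q t = f (φ t) := by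
      have := mul_eq_mul_of_mem_ideal f φ t ⟨x, hxJ⟩
      rw [mul_assoc, mul_comm (f _), this, ← mul_assoc]
      simp [← hu]
    refine ⟨⟨((u⁻¹ : Qˣ) : Q) * f (φ ⟨x, hxJ⟩), ?_⟩, ?_⟩
    · rintro _ ⟨t, ht, rfl⟩
      exact ⟨φ ⟨t, ht⟩, (key ⟨t, ht⟩).symm⟩
    · ext t
      apply hf
      rw [apply_divToHom, key]

end HomDiv

/-! ### `Ext¹(k, M)` from the sequence `0 → m → R → k → 0`. -/

section ExtOne

variable {R : Type u} [CommRing R] [IsLocalRing R] {Q : Type*} [CommRing Q] [Algebra R Q]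
  [IsFractionRing R Q]

open Submodule IsLocalization Abelian

/-- The short exact sequence `0 → m → R → k → 0`. -/
noncomputable abbrev maximalIdealShortComplex (R : Type u) [CommRing R] [IsLocalRing R] :
    ShortComplex (ModuleCat.{u} R) :=
  ShortComplex.mk (ModuleCat.ofHom (maximalIdeal R).subtype)
    (ModuleCat.ofHom (Algebra.linearMap R (ResidueField R))) (by
      ext x
      exact (residue_eq_zero_iff _).2 x.2)

theorem maximalIdealShortComplex_shortExact : (maximalIdealShortComplex R).ShortExact where
  exact := by
    refine (ShortComplex.ShortExact.moduleCat_exact_iff_function_exact _).2 ?_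
    intro x
    refine (residue_eq_zero_iff x).trans ?_
    exact ⟨fun h => ⟨⟨x, h⟩, rfl⟩, by rintro ⟨y, rfl⟩; exact y.2⟩
  mono_f := (ModuleCat.mono_iff_injective _).2 Subtype.val_injective
  epi_g := (ModuleCat.epi_iff_surjective _).2 residue_surjective

/-- The connecting homomorphism `Hom(m, M) → Ext¹(k, M)`. -/
noncomputable def homToExtResidueField (M : Type u) [AddCommGroup M] [Module R M] :
    (maximalIdeal R →ₗ[R] M) →ₗ[R] ExtResidueField R M 1 where
  toFun φ := (maximalIdealShortComplex_shortExact (R := R)).extClass.comp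
    (Ext.mk₀ (ModuleCat.ofHom φ : ModuleCat.of R (maximalIdeal R) ⟶ ModuleCat.of R M)) (add_zero 1)
  map_add' φ ψ := by
    rw [ModuleCat.ofHom_add, Ext.mk₀_add, Ext.comp_add]
  map_smul' r φ := by
    rw [RingHom.id_apply, ← Ext.comp_smul, ← Ext.mk₀_smul]
    rfl

theorem homToExtResidueField_surjective (M : Type u) [AddCommGroup M] [Module R M] :
    Function.Surjective (homToExtResidueField (R := R) M) := by
  intro e
  have : Projective (maximalIdealShortComplex R).X₂ :=
    inferInstanceAs (Projective (ModuleCat.of R R))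
  obtain ⟨y, hy⟩ := precomp_extClass_surjective_of_projective_X₂ (ModuleCat.of R M)
    (maximalIdealShortComplex_shortExact (R := R)) 0 e
  obtain ⟨g, rfl⟩ := Ext.mk₀_bijective _ _ |>.2 y
  exact ⟨g.hom, hy⟩

theorem homToExtResidueField_eq_zero_iff (M : Type u) [AddCommGroup M] [Module R M]
    (φ : maximalIdeal R →ₗ[R] M) :
    homToExtResidueField M φ = 0 ↔ ∃ m : M, ∀ t : maximalIdeal R, φ t = (t : R) • m := by
  constructor
  · intro h
    obtain ⟨y, hy⟩ := Ext.contravariant_sequence_exact₁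
      (maximalIdealShortComplex_shortExact (R := R)) _ _ (add_zero 1) h
    obtain ⟨g, rfl⟩ := Ext.mk₀_bijective _ _ |>.2 y
    rw [Ext.mk₀_comp_mk₀] at hy
    have h2 := (Ext.mk₀_bijective _ _).1 hy
    let g' : R →ₗ[R] M := g.hom
    refine ⟨g' 1, fun t => ?_⟩
    rw [← map_smul, smul_eq_mul, mul_one]
    exact (congrArg (fun f => ModuleCat.Hom.hom f t) h2).symm
  · rintro ⟨m, hm⟩
    have h : (ModuleCat.ofHom φ : ModuleCat.of R (maximalIdeal R) ⟶ ModuleCat.of R M) =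
        (maximalIdealShortComplex R).f ≫
          (ModuleCat.ofHom (LinearMap.toSpanSingleton R M m) :
            ModuleCat.of R R ⟶ ModuleCat.of R M) := by
      ext t
      exact hm t
    change (maximalIdealShortComplex_shortExact (R := R)).extClass.comp (Ext.mk₀ _) (add_zero 1) = 0
    rw [h, ← Ext.mk₀_comp_mk₀, ShortComplex.ShortExact.extClass_comp_assoc]

/-- `Ext¹(k, M)` computed in the total quotient ring. -/
theorem length_extResidueField_one {M : Type u} [AddCommGroup M] [Module R M] (f : M →ₗ[R] Q)
    (hf : Function.Injective f) (hm : ∃ x ∈ nonZeroDivisors R, x ∈ maximalIdeal R) :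
    Module.length R (ExtResidueField R M 1) =
      relLength (LinearMap.range f) (LinearMap.range f / coeSubmodule Q (maximalIdeal R)) := by
  symm
  refine relLength_eq_length (homToExtResidueField M ∘ₗ divToHom f hf (maximalIdeal R))
    ((homToExtResidueField_surjective M).comp (divToHom_bijective f hf _ hm).2) fun z => ?_
  rw [LinearMap.comp_apply, homToExtResidueField_eq_zero_iff]
  constructor
  · rintro ⟨m, h⟩
    obtain ⟨x, hx, hxm⟩ := hm
    refine ⟨m, ?_⟩
    have := congrArg f (h ⟨x, hxm⟩)
    rw [apply_divToHom, map_smul, Algebra.smul_def, mul_comm] at this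
    exact ((map_units Q (⟨x, hx⟩ : nonZeroDivisors R)).mul_left_cancel this).symm
  · rintro ⟨m, h⟩
    refine ⟨m, fun t => hf ?_⟩
    rw [apply_divToHom, map_smul, Algebra.smul_def, mul_comm, h]

end ExtOne

/-! ### Multiplicities and Hilbert coefficients through a principal reduction. -/

section Multiplicity

variable {R : Type u} [CommRing R] {Q : Type*} [CommRing Q] [Algebra R Q]

open Submodule IsLocalization

theorem coeSubmodule_pow (I : Ideal R) (n : ℕ) :
    coeSubmodule Q (I ^ n) = coeSubmodule Q I ^ n := by
  induction n with
  | zero => rw [pow_zero, pow_zero, Ideal.one_eq_top, coeSubmodule_top]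
  | succ n ih => rw [pow_succ, pow_succ, coeSubmodule_mul, ih]

theorem ideal_smul_eq_coeSubmodule_mul (I : Ideal R) (X : Submodule R Q) :
    I • X = coeSubmodule Q I * X := by
  apply le_antisymm
  · refine smul_le.2 fun r hr x hx => ?_
    rw [Algebra.smul_def]
    exact mul_mem_mul ⟨r, hr, rfl⟩ hx
  · refine Submodule.mul_le.2 ?_
    rintro _ ⟨r, hr, rfl⟩ x hx
    rw [Algebra.linearMap_apply, ← Algebra.smul_def]
    exact smul_mem_smul hr hx

theorem map_ideal_smul {M : Type*} [AddCommGroup M] [Module R M] (f : M →ₗ[R] Q) (I : Ideal R)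
    (N : Submodule R M) : (I • N).map f = coeSubmodule Q I * N.map f := by
  rw [map_smul'', ideal_smul_eq_coeSubmodule_mul]

theorem range_linearMap_eq_one : LinearMap.range (Algebra.linearMap R Q) = 1 := by
  rw [← coeSubmodule_top (S := Q), coeSubmodule, Submodule.map_top]

/-- In the chain `X ⊇ uX ⊇ … ⊇ uʲX ⊇ uʲY` all steps but the last are scaled copies of `X/uX`, and
the last is a copy of `X/Y`. -/
theorem relLength_span_unit_pow_mul (u : Qˣ) {X Y : Submodule R Q} (hYX : Y ≤ X)
    (hX : span R {(u : Q)} * X ≤ X) (j : ℕ) :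
    relLength (span R {(u : Q)} ^ j * Y) X =
      j * relLength (span R {(u : Q)} * X) X + relLength Y X := by
  have hle (j : ℕ) : span R {(u : Q)} ^ j * Y ≤ X := by
    induction j with
    | zero => simpa using hYX
    | succ j ih =>
      rw [pow_succ', mul_assoc]
      exact (mul_le_mul_right ih _).trans hX
  induction j with
  | zero => simp
  | succ j ih =>
    rw [pow_succ', mul_assoc, relLength_add (mul_le_mul_right (hle j) _) hX,
      relLength_span_unit_mul, ih]
    push_cast
    ring

theorem pow_add_eq {W t : Submodule R Q} {n : ℕ} (h : t * W ^ n = W ^ (n + 1)) (j : ℕ) :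
    W ^ (n + j) = t ^ j * W ^ n := by
  induction j with
  | zero => simp
  | succ j ih => rw [← add_assoc, pow_succ, ih, mul_assoc, ← pow_succ, ← h, pow_succ, mul_assoc]

variable [IsLocalRing R] [IsNoetherianRing R] [IsFractionRing R Q]
  (hfin : ∀ b ∈ nonZeroDivisors R, IsArtinianRing (R ⧸ Ideal.span {b}))

include hfin

-- Beyond the reduction exponent `Iⁿ⁰⁺ʲX = uʲIⁿ⁰X`, so the length function is linear with slope
-- `ℓ(X/uX)`.
omit [IsLocalRing R] in
theorem isMultiplicity_iff {I : Ideal R} {M : Type u} [AddCommGroup M] [Module R M]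
    {f : M →ₗ[R] Q} (hf : Function.Injective f) (hX : IsRegFrac (LinearMap.range f)) {u : Qˣ}
    (hu : (u : Q) ∈ coeSubmodule Q I) {n₀ : ℕ}
    (hn : span R {(u : Q)} * coeSubmodule Q I ^ n₀ = coeSubmodule Q I ^ (n₀ + 1)) (e : ℝ) :
    IsMultiplicity 1 I M e ↔
      e = (relLength (span R {(u : Q)} * LinearMap.range f) (LinearMap.range f)).toNat := by
  have hW1 : coeSubmodule Q I ≤ 1 := by
    rw [← coeSubmodule_top (S := Q)]
    exact coeSubmodule_mono Q le_top
  set X := LinearMap.range f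
  set W := coeSubmodule Q I with hW
  set t := span R {(u : Q)} with ht
  have htW : t ≤ W := by simpa [ht] using hu
  have hWX (k : ℕ) : W ^ k * X ≤ X := by
    have : W ^ k ≤ 1 := by simpa using pow_le_pow_left' hW1 k
    simpa using mul_le_mul_left this X
  have htX : t * X ≤ X := (mul_le_mul_left htW X).trans (by simpa using hWX 1)
  have hWreg : IsRegFrac W := ⟨(IsNoetherian.noetherian I).map _, u, hu⟩
  have hlen (j : ℕ) : Module.length R (M ⧸ (I ^ (n₀ + j) • (⊤ : Submodule R M))) =
      j * relLength (t * X) X + relLength (W ^ n₀ * X) X := by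
    rw [length_quotient_eq_relLength hf, map_ideal_smul, coeSubmodule_pow, Submodule.map_top,
      pow_add_eq hn, mul_assoc, relLength_span_unit_pow_mul u (hWX n₀) htX]
  have h₁ : relLength (t * X) X ≠ ⊤ :=
    relLength_ne_top hfin hX.1 ((isRegFrac_span_unit u).mul hX).2
  have h₂ : relLength (W ^ n₀ * X) X ≠ ⊤ :=
    relLength_ne_top hfin hX.1 ((hWreg.pow n₀).mul hX).2
  generalize relLength (t * X) X = e₀ at *
  generalize relLength (W ^ n₀ * X) X = c at *
  lift e₀ to ℕ using h₁
  lift c to ℕ using h₂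
  have hlim : IsMultiplicity 1 I M e₀ := by
    have h : Tendsto (fun n : ℕ => (e₀ : ℝ) + ((c : ℝ) - n₀ * e₀) / n) atTop (𝓝 (e₀ + 0)) :=
      tendsto_const_nhds.add (tendsto_const_div_atTop_nhds_zero_nat _)
    rw [add_zero] at h
    refine h.congr' ?_
    filter_upwards [eventually_ge_atTop (n₀ + 1)] with n hn
    obtain ⟨j, rfl⟩ := Nat.exists_eq_add_of_le (Nat.le_of_succ_le hn)
    have hpos : ((n₀ + j : ℕ) : ℝ) ≠ 0 := by
      norm_cast
      omega
    rw [hlen]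
    have : ((j : ℕ∞) * (e₀ : ℕ∞) + (c : ℕ∞)).toNat = j * e₀ + c := by
      norm_cast
    rw [this]
    field_simp
    push_cast
    simp
    ring
  constructor
  · intro h
    simpa using tendsto_nhds_unique h hlim
  · rintro rfl
    simpa using hlim

/-- The multiplicity `ℓ(X/uX)` may be computed on `IX` instead, as `ℓ(IX/uIX) = ℓ(IX/I²X) +
ℓ(I²X/uIX)`. Minimality is the vanishing of the last term, which after division by `u²` says that
`KX` is stable under `K`. -/
theorem hasMinimalMultiplicity_iff {I : Ideal R} (hI : IsMaximalPrimary I) {M : Type u}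
    [AddCommGroup M] [Module R M] {f : M →ₗ[R] Q} (hf : Function.Injective f)
    (hX : IsRegFrac (LinearMap.range f)) {u : Qˣ}
    (hu : (u : Q) ∈ coeSubmodule Q I) {n₀ : ℕ}
    (hn : span R {(u : Q)} * coeSubmodule Q I ^ n₀ = coeSubmodule Q I ^ (n₀ + 1))
    {K : Submodule R Q} (hK : coeSubmodule Q I = span R {(u : Q)} * K) :
    HasMinimalMultiplicity I M ↔ K * (K * LinearMap.range f) ≤ K * LinearMap.range f := by
  have hmult := isMultiplicity_iff hfin hf hX hu hn
  have hW1 : coeSubmodule Q I ≤ 1 := by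
    rw [← coeSubmodule_top (S := Q)]
    exact coeSubmodule_mono Q le_top
  have hlen : Module.length R ((I • ⊤ : Submodule R M) ⧸
      (I • ⊤ : Submodule R (I • ⊤ : Submodule R M))) =
      relLength (coeSubmodule Q I * (coeSubmodule Q I * LinearMap.range f))
        (coeSubmodule Q I * LinearMap.range f) := by
    have hr : LinearMap.range (f ∘ₗ (I • ⊤ : Submodule R M).subtype) =
        coeSubmodule Q I * LinearMap.range f := by
      rw [LinearMap.range_comp, range_subtype, map_ideal_smul, Submodule.map_top]
    rw [length_quotient_eq_relLength (f := f ∘ₗ (I • ⊤ : Submodule R M).subtype)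
      (hf.comp Subtype.val_injective), map_ideal_smul, Submodule.map_top, hr]
  have hWreg : IsRegFrac (coeSubmodule Q I) := ⟨(IsNoetherian.noetherian I).map _, u, hu⟩
  have hfinite : Module.Finite R M :=
    Module.Finite.iff_fg.2 hX.1 |>.equiv (LinearEquiv.ofInjective f hf).symm
  have hnontriv : Nontrivial M := by
    have : Nontrivial Q := (IsFractionRing.injective R Q).nontrivial
    obtain ⟨v, m, hm⟩ := hX.2
    refine ⟨m, 0, fun h => v.ne_zero ?_⟩
    rw [← hm, h, map_zero]
  have htf : Module.IsTorsionFree R M := by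
    refine ⟨fun r hr m m' h => hf ?_⟩
    have h2 := congrArg f h
    simp only [map_smul, Algebra.smul_def] at h2
    exact (map_units Q (⟨r, hr.mem_nonZeroDivisors⟩ : nonZeroDivisors R)).mul_left_cancel h2
  have hiff : HasMinimalMultiplicity I M ↔ IsMultiplicity 1 I M
    ((Module.length R ((I • ⊤ : Submodule R M) ⧸
      (I • ⊤ : Submodule R (I • ⊤ : Submodule R M)))).toNat : ℝ) :=
    ⟨fun h => h.multiplicity_eq, fun h => ⟨hI, hfinite, hnontriv, htf, h⟩⟩
  rw [hiff, hmult, hlen]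
  set X := LinearMap.range f
  set W := coeSubmodule Q I
  set t := span R {(u : Q)} with ht
  have htW : t ≤ W := by simpa [ht] using hu
  have hWX : W * X ≤ X := by simpa using mul_le_mul_left hW1 X
  have htX : t * X ≤ X := (mul_le_mul_left htW X).trans hWX
  have hWWX : W * (W * X) ≤ W * X := mul_le_mul_right hWX W
  have htWX : t * (W * X) ≤ W * (W * X) := mul_le_mul_left htW _
  have hWXreg := hWreg.mul hX
  rw [relLength_span_unit_mul_self hfin u hX hWXreg htX (htWX.trans hWWX),
    relLength_add htWX hWWX]
  have h₁ : relLength (t * (W * X)) (W * (W * X)) ≠ ⊤ :=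
    relLength_ne_top hfin (hWreg.mul hWXreg).1 ((isRegFrac_span_unit u).mul hWXreg).2
  have h₂ : relLength (W * (W * X)) (W * X) ≠ ⊤ :=
    relLength_ne_top hfin hWXreg.1 (hWreg.mul hWXreg).2
  have key : relLength (t * (W * X)) (W * (W * X)) = 0 ↔ K * (K * X) ≤ K * X := by
    have hs : W * (W * X) = t * (t * (K * (K * X))) := by
      rw [hK]
      ring
    have hs' : t * (W * X) = t * (t * (K * X)) := by
      rw [hK]
      ring
    rw [← relLength_eq_zero_iff, hs, hs', relLength_span_unit_mul, relLength_span_unit_mul]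
  rw [← key]
  generalize relLength (t * (W * X)) (W * (W * X)) = a at *
  generalize relLength (W * (W * X)) (W * X) = b at *
  lift a to ℕ using h₁
  lift b to ℕ using h₂
  rw [← Nat.cast_add, ENat.toNat_natCast, ENat.toNat_natCast, Nat.cast_inj, Nat.cast_eq_zero]
  omega

-- For large `N` one has `uᴺR ⊆ Iᴺ = uᴺKⁿ⁰ ⊆ R`, whence `N ℓ(R/uR) = ℓ(Kⁿ⁰/R) + ℓ(R/Iᴺ)`.
omit [IsLocalRing R] in
theorem isFirstHilbertCoeff_iff {I : Ideal R} {u : Qˣ}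
    (hu : (u : Q) ∈ coeSubmodule Q I) {K : Submodule R Q}
    (hK : coeSubmodule Q I = span R {(u : Q)} * K) {n₀ : ℕ} (hn : K ^ (n₀ + 1) = K ^ n₀) (e₁ : ℤ) :
    IsFirstHilbertCoeff I e₁ ↔ e₁ = (relLength 1 (K ^ n₀)).toNat := by
  have hW1 : coeSubmodule Q I ≤ 1 := by
    rw [← coeSubmodule_top (S := Q)]
    exact coeSubmodule_mono Q le_top
  have hWreg : IsRegFrac (coeSubmodule Q I) := ⟨(IsNoetherian.noetherian I).map _, u, hu⟩
  set t := span R {(u : Q)} with ht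
  have htW : t ≤ coeSubmodule Q I := by simpa [ht] using hu
  have ht1 : t * 1 ≤ 1 := by simpa using htW.trans hW1
  have hKpow (j : ℕ) : K ^ (n₀ + j) = K ^ n₀ := by
    induction j with
    | zero => rfl
    | succ j ih => rw [← add_assoc, pow_succ, ih, ← pow_succ, hn]
  have hKreg : IsRegFrac K := by
    have : K = span R {((u⁻¹ : Qˣ) : Q)} * coeSubmodule Q I := by
      rw [hK, ← mul_assoc, span_inv_mul_span_unit, one_mul]
    rw [this]
    exact (isRegFrac_span_unit _).mul hWreg
  have hlen (N : ℕ) (hN : n₀ ≤ N) : relLength 1 (K ^ n₀) + Module.length R (R ⧸ I ^ N) =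
      N * relLength t 1 := by
    obtain ⟨j, rfl⟩ := Nat.exists_eq_add_of_le hN
    have hpow : coeSubmodule Q I ^ (n₀ + j) = t ^ (n₀ + j) * K ^ n₀ := by
      rw [hK, mul_pow, hKpow]
    rw [length_quotient_eq_relLength (f := Algebra.linearMap R Q) (IsFractionRing.injective R Q),
      range_linearMap_eq_one]
    change _ + relLength (coeSubmodule Q (I ^ (n₀ + j))) 1 = _
    rw [coeSubmodule_pow]
    have h := relLength_span_unit_pow_mul u le_rfl ht1 (n₀ + j)
    rw [relLength_eq_zero_iff.2 le_rfl, add_zero, mul_one, mul_one] at h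
    rw [← h, relLength_add (pow_le_pow_left' htW (n₀ + j))
      (by simpa using pow_le_pow_left' hW1 (n₀ + j))]
    congr 1
    have hu' : span R {((u ^ (n₀ + j) : Qˣ) : Q)} = t ^ (n₀ + j) := by
      rw [ht, span_pow, Set.singleton_pow, Units.val_pow_eq_pow_val]
    rw [hpow, ← hu', ← relLength_span_unit_mul (u ^ (n₀ + j)), mul_one]
  have h₁ : relLength t 1 ≠ ⊤ :=
    relLength_ne_top hfin isRegFrac_one.1 (isRegFrac_span_unit u).2
  have h₂ : relLength 1 (K ^ n₀) ≠ ⊤ :=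
    relLength_ne_top hfin (hKreg.pow n₀).1 isRegFrac_one.2
  generalize relLength t 1 = e at *
  generalize relLength 1 (K ^ n₀) = s at *
  lift e to ℕ using h₁
  lift s to ℕ using h₂
  have hlen' (N : ℕ) (hN : n₀ ≤ N) :
      ((Module.length R (R ⧸ I ^ N)).toNat : ℤ) = (e : ℤ) * N - s := by
    have h := hlen N hN
    have h3 : Module.length R (R ⧸ I ^ N) ≠ ⊤ := by
      intro h'
      rw [h'] at h
      norm_cast at h
    lift Module.length R (R ⧸ I ^ N) to ℕ using h3 with l
    norm_cast at h
    rw [ENat.toNat_natCast, mul_comm, eq_sub_iff_add_eq, add_comm]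
    exact_mod_cast h
  rw [ENat.toNat_natCast]
  constructor
  · rintro ⟨e₀, h⟩
    -- Two consecutive values determine the slope `e₀`, and then `e₁`.
    obtain ⟨N, hN⟩ := eventually_atTop.1 (h.and (eventually_ge_atTop n₀))
    have h1 := hN N le_rfl
    have h2 := hN (N + 1) (by omega)
    rw [hlen' _ (by omega)] at h1 h2
    have h3 := h1.1
    have h4 := h2.1
    push_cast at h3 h4
    have h5 : e₀ = e := by linear_combination h3 - h4
    rw [h5] at h3
    linear_combination h3
  · rintro rfl
    refine ⟨e, ?_⟩
    filter_upwards [eventually_ge_atTop n₀] with n hn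
    rw [hlen' _ (by omega)]
    push_cast
    rfl

end Multiplicity

/-! ### Each condition amounts to `K m ⊆ R`. -/

section Conditions

variable {R Q : Type*} [CommRing R] [CommRing Q] [Algebra R Q]

open Submodule IsLocalization

/-- Here `K : KX = (K : K) : X` coincides with `R : X`, and the left side inherits stability under
`K` from `KX`. -/
theorem mul_one_div_le_of_mul_mul_le {K X : Submodule R Q} (hK : K / K ≤ 1)
    (h : K * (K * X) ≤ K * X) : K * (1 / X) ≤ 1 / X := by
  have h1 : K / (K * X) ≤ 1 / X := by
    rw [div_mul_eq]
    exact div_mono_left hK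
  have h2 : 1 / X ≤ K / (K * X) := by
    rw [Submodule.le_div_iff_mul_le, mul_left_comm]
    exact (mul_le_mul_right (div_mul_le 1 X) K).trans (mul_one K).le
  refine le_trans ?_ h1
  rw [Submodule.le_div_iff_mul_le]
  refine le_trans ?_ (Submodule.le_div_iff_mul_le.1 h2)
  calc K * (1 / X) * (K * X) = (1 / X) * (K * (K * X)) := by ring
    _ ≤ (1 / X) * (K * X) := mul_le_mul_right h _

variable [IsLocalRing R] [IsNoetherianRing R] [IsFractionRing R Q]

/-- Over a local ring of dimension one which is not regular, `(R : m) m ≤ m`. -/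
theorem one_div_mul_maximalIdeal_le (hdim : ringKrullDim R = 1) (hreg : ¬ IsRegularLocalRing R) :
    (1 / coeSubmodule Q (maximalIdeal R)) * coeSubmodule Q (maximalIdeal R) ≤
      coeSubmodule Q (maximalIdeal R) := by
  refine Submodule.mul_le.2 fun z hz y hy => ?_
  by_contra hzy
  obtain ⟨r, hr⟩ := mem_one.1 (hz y hy)
  have hru : IsUnit r := by
    by_contra hn
    exact hzy ⟨r, (mem_maximalIdeal r).2 hn, hr⟩
  obtain ⟨y, hym, rfl⟩ := hy
  rw [Algebra.linearMap_apply] at hr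
  -- If `zy = r` is a unit, then `r t = (z t) y` with `z t ∈ R` for every `t ∈ m`; so `y` generates
  -- `m` and `R` is regular.
  have hle : maximalIdeal R ≤ Ideal.span {y} := by
    intro t ht
    obtain ⟨s, hs⟩ := mem_one.1 (hz _ ⟨t, ht, rfl⟩)
    rw [Algebra.linearMap_apply] at hs
    have h : r * t = s * y := by
      apply IsFractionRing.injective R Q
      rw [map_mul, map_mul, hr, hs]
      ring
    rw [Ideal.mem_span_singleton]
    exact hru.dvd_mul_left.1 ⟨s, by rw [h, mul_comm]⟩
  have heq : maximalIdeal R = Ideal.span {y} :=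
    le_antisymm hle ((Ideal.span_singleton_le_iff_mem _).2 hym)
  refine hreg (IsRegularLocalRing.of_spanFinrank_maximalIdeal_le R ?_)
  rw [hdim, heq]
  have := spanFinrank_span_le_ncard_of_finite (R := R) (Set.finite_singleton y)
  rw [Set.ncard_singleton] at this
  exact_mod_cast this

variable {K : Submodule R Q} (hKK : K / K ≤ 1)

include hKK

omit [IsLocalRing R] [IsNoetherianRing R] [IsFractionRing R Q] in
theorem mul_le_one_of_mul_mul_le {X : Submodule R Q} (hX : X ≤ 1) (h : K * (K * X) ≤ K * X) :
    K * X ≤ 1 := by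
  rw [← Submodule.le_div_iff_mul_le]
  refine le_trans ?_ (mul_one_div_le_of_mul_mul_le hKK h)
  simpa using mul_le_mul_right (one_le_one_div.2 hX) K

theorem mul_mul_maximalIdeal_le_iff (hdim : ringKrullDim R = 1)
    (hreg : ¬ IsRegularLocalRing R) :
    K * (K * coeSubmodule Q (maximalIdeal R)) ≤ K * coeSubmodule Q (maximalIdeal R) ↔
      K * coeSubmodule Q (maximalIdeal R) ≤ 1 := by
  constructor
  · refine mul_le_one_of_mul_mul_le hKK ?_
    rw [← coeSubmodule_top (S := Q)]
    exact coeSubmodule_mono Q le_top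
  · intro h
    rw [← Submodule.le_div_iff_mul_le] at h
    refine mul_le_mul_right ?_ K
    exact (mul_le_mul_left h _).trans (one_div_mul_maximalIdeal_le hdim hreg)

theorem mul_mul_one_div_maximalIdeal_le_iff (hdim : ringKrullDim R = 1)
    (hreg : ¬ IsRegularLocalRing R) :
    K * (K * (1 / coeSubmodule Q (maximalIdeal R))) ≤
        K * (1 / coeSubmodule Q (maximalIdeal R)) ↔
      K * coeSubmodule Q (maximalIdeal R) ≤ 1 := by
  have hm1 : coeSubmodule Q (maximalIdeal R) ≤ 1 := by
    rw [← coeSubmodule_top (S := Q)]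
    exact coeSubmodule_mono Q le_top
  have hmB := one_div_mul_maximalIdeal_le (Q := Q) hdim hreg
  set m := coeSubmodule Q (maximalIdeal R)
  constructor
  · intro h
    have h2 := mul_one_div_le_of_mul_mul_le hKK h
    have h3 : m ≤ 1 / (1 / m) := by
      rw [Submodule.le_div_iff_mul_le]
      exact mul_one_div_le_one
    refine (mul_le_mul_right h3 K).trans (h2.trans ?_)
    exact (div_anti_right (one_le_one_div.2 hm1)).trans (div_one_eq 1).le
  · intro h
    rw [← Submodule.le_div_iff_mul_le] at h
    refine mul_le_mul_right ?_ K
    refine (mul_le_mul_left h _).trans ?_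
    rw [Submodule.le_div_iff_mul_le, mul_assoc]
    exact (mul_le_mul_right hmB _).trans (Submodule.le_div_iff_mul_le.1 le_rfl)

/-- If `Kⁿ ⊆ K`, then `K ⊆ K : K ⊆ R`. Otherwise `ℓ(Kⁿ/K) ≥ 1`. The type is `ℓ(K/mK) ≤ 1 + ℓ(K/(mK +
R))`, so `ℓ(Kⁿ/R)` can stay below it only if `ℓ((mK + R)/R) = 0`. Conversely `K m ⊆ R` puts every
power of `K` inside `R : m`, as `(R : m)m ⊆ m`. -/
theorem relLength_pow_le_iff (h1K : 1 ≤ K)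
    (hfin : ∀ b ∈ nonZeroDivisors R, IsArtinianRing (R ⧸ Ideal.span {b}))
    (hdim : ringKrullDim R = 1) (hreg : ¬ IsRegularLocalRing R) (hKreg : IsRegFrac K)
    (hmreg : IsRegFrac (coeSubmodule Q (maximalIdeal R)))
    (hm : relLength (coeSubmodule Q (maximalIdeal R)) 1 ≤ 1)
    (hdual : relLength 1 (1 / coeSubmodule Q (maximalIdeal R)) =
      relLength (coeSubmodule Q (maximalIdeal R) * K) K) {n : ℕ} (hn : 2 ≤ n) :
    relLength 1 (K ^ n) ≤ relLength 1 (1 / coeSubmodule Q (maximalIdeal R)) ↔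
      K * coeSubmodule Q (maximalIdeal R) ≤ 1 := by
  have hm1 : coeSubmodule Q (maximalIdeal R) ≤ 1 := by
    rw [← coeSubmodule_top (S := Q)]
    exact coeSubmodule_mono Q le_top
  have hmB := one_div_mul_maximalIdeal_le (Q := Q) hdim hreg
  set m := coeSubmodule Q (maximalIdeal R)
  have hKn (k : ℕ) (hk : k ≤ n) : K ^ k ≤ K ^ n := pow_le_pow_right' h1K hk
  have h1n : 1 ≤ K ^ n := by simpa using hKn 0 (by omega)
  have hK1n : K ≤ K ^ n := by simpa using hKn 1 (by omega)
  constructor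
  · intro h
    by_cases hc : K ^ n ≤ K
    · have h2 : K * K ≤ K := by
        rw [← pow_two]
        exact (hKn 2 hn).trans hc
      have h3 : K ≤ 1 := (Submodule.le_div_iff_mul_le.2 h2).trans hKK
      exact (mul_le_mul' h3 hm1).trans (mul_one 1).le
    · rw [← relLength_eq_zero_iff] at hc
      have hmK : m ≤ m * K := by simpa using mul_le_mul_right h1K m
      have hmKK : m * K ≤ K := by simpa using mul_le_mul_left hm1 K
      have e₁ := relLength_add (Y := m * K) (Z := m * K ⊔ 1) le_sup_left (sup_le hmKK h1K)
      have e₂ := relLength_add (Y := 1) (Z := m * K ⊔ 1) le_sup_right (sup_le hmKK h1K)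
      have e₃ := relLength_add h1K hK1n
      have e₄ : relLength (m * K) (m * K ⊔ 1) ≤ 1 := by
        rw [relLength_sup_right]
        exact (relLength_antitone_left (le_inf hmK hm1) inf_le_right).trans hm
      have f : relLength 1 (K ^ n) ≠ ⊤ :=
        relLength_ne_top hfin (hKreg.pow n).1 isRegFrac_one.2
      have g : relLength (m * K) K ≠ ⊤ :=
        relLength_ne_top hfin hKreg.1 (hmreg.mul hKreg).2
      rw [hdual, e₁, e₃, e₂] at h
      rw [e₃, e₂] at f
      rw [e₁] at g
      have key : relLength 1 (m * K ⊔ 1) = 0 := by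
        generalize relLength 1 (m * K ⊔ 1) = a at *
        generalize relLength (m * K ⊔ 1) K = b at *
        generalize relLength K (K ^ n) = c at *
        generalize relLength (m * K) (m * K ⊔ 1) = d at *
        simp only [ne_eq, ENat.add_eq_top, not_or] at f g
        obtain ⟨⟨ha, hb⟩, hc'⟩ := f
        lift a to ℕ using ha
        lift b to ℕ using hb
        lift c to ℕ using hc'
        lift d to ℕ using g.1
        norm_cast at *
        omega
      rw [mul_comm]
      exact le_sup_left.trans (relLength_eq_zero_iff.1 key)
  · intro h
    refine relLength_mono_right h1n ?_
    have hKB : K ≤ 1 / m := Submodule.le_div_iff_mul_le.2 h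
    have hmul (k : ℕ) : K ^ k * m ≤ m := by
      induction k with
      | zero => simp
      | succ k ih =>
        rw [pow_succ, mul_assoc]
        exact (mul_le_mul_right ((mul_le_mul_left hKB m).trans hmB) _).trans ih
    rw [Submodule.le_div_iff_mul_le]
    exact (hmul n).trans hm1

end Conditions

/-! ### Canonical ideals and their normalizations `K`. -/

section CanonicalIdeal

variable {R : Type u} [CommRing R] [IsLocalRing R] [IsNoetherianRing R]

open Submodule IsLocalization

theorem exists_nonZeroDivisor_mem_maximalIdeal (hCM : IsCohenMacaulayLocal R)
    (hdim : ringKrullDim R = 1) : ∃ x ∈ nonZeroDivisors R, x ∈ maximalIdeal R := by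
  obtain ⟨rs, hrs, hlen⟩ := hCM
  rw [hdim] at hlen
  obtain ⟨x, rfl⟩ := List.length_eq_one_iff.1 (by exact_mod_cast hlen : rs.length = 1)
  refine ⟨x, ?_, ?_⟩
  · have h := ((RingTheory.Sequence.isRegular_cons_iff R x []).1 hrs).1
    rw [mem_nonZeroDivisors_iff_left]
    intro y hy
    exact h (by simpa using hy)
  · rw [mem_maximalIdeal, mem_nonunits_iff]
    intro hx
    have h := hrs.top_ne_smul
    apply h
    simp [Ideal.span_singleton_eq_top.2 hx]

omit [IsLocalRing R] in
theorem isArtinianRing_quotient_span_of_nonZeroDivisor (hdim : ringKrullDim R = 1) (b : R)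
    (hb : b ∈ nonZeroDivisors R) : IsArtinianRing (R ⧸ Ideal.span {b}) := by
  rw [isArtinianRing_iff_isNoetherianRing_krullDimLE_zero, Ring.krullDimLE_iff]
  refine ⟨inferInstance, ?_⟩
  have h := ringKrullDim_quotient_succ_le_of_nonZeroDivisor hb
  rw [hdim] at h
  generalize ringKrullDim (R ⧸ Ideal.span {b}) = d at h ⊢
  induction d with
  | bot => exact bot_le
  | coe n =>
    norm_cast at h ⊢
    exact_mod_cast (ENat.add_le_add_iff_right ENat.one_ne_top).1 (h.trans (zero_add 1).ge)

variable {Q : Type*} [CommRing Q] [Algebra R Q]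

/-- The unit `u` lies in `I Q` and generates a reduction of it, where `I Q = u K`. -/
structure IsReducedTo (I : Ideal R) (u : Qˣ) (K : Submodule R Q) (n : ℕ) : Prop where
  mem : (u : Q) ∈ coeSubmodule Q I
  eq : coeSubmodule Q I = span R {(u : Q)} * K
  pow_succ_eq : K ^ (n + 1) = K ^ n

namespace IsReducedTo

variable {I : Ideal R} {u : Qˣ} {K : Submodule R Q} {n : ℕ} (h : IsReducedTo I u K n)

include h

omit [IsLocalRing R] [IsNoetherianRing R] in
theorem one_le : 1 ≤ K := by
  have h1 : span R {(u : Q)} * 1 ≤ span R {(u : Q)} * K := by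
    rw [← h.eq, mul_one, span_singleton_le_iff_mem]
    exact h.mem
  rwa [span_unit_mul_le_iff, ← mul_assoc, span_inv_mul_span_unit, one_mul] at h1

omit [IsLocalRing R] [IsNoetherianRing R] in
theorem pow_eq {k : ℕ} (hk : n ≤ k) : K ^ k = K ^ n := by
  induction k, hk using Nat.le_induction with
  | base => rfl
  | succ k _ ih => rw [pow_succ, ih, ← pow_succ, h.pow_succ_eq]

omit [IsLocalRing R] [IsNoetherianRing R] in
theorem span_mul_pow_eq :
    span R {(u : Q)} * coeSubmodule Q I ^ n = coeSubmodule Q I ^ (n + 1) := by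
  rw [h.eq, mul_pow, mul_pow, h.pow_succ_eq, ← mul_assoc, ← pow_succ']

omit [IsLocalRing R] in
theorem isRegFrac_coeSubmodule : IsRegFrac (coeSubmodule Q I) :=
  ⟨(IsNoetherian.noetherian I).map _, u, h.mem⟩

omit [IsLocalRing R] in
theorem isRegFrac : IsRegFrac K := by
  have : K = span R {((u⁻¹ : Qˣ) : Q)} * coeSubmodule Q I := by
    rw [h.eq, ← mul_assoc, span_inv_mul_span_unit, one_mul]
  rw [this]
  exact (isRegFrac_span_unit _).mul h.isRegFrac_coeSubmodule

omit [IsLocalRing R] [IsNoetherianRing R] in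
theorem div_self_le : K / K ≤ coeSubmodule Q I / coeSubmodule Q I := by
  rw [h.eq, Submodule.le_div_iff_mul_le, mul_left_comm]
  exact mul_le_mul_right (div_mul_le K K) _

-- Rescaling the ideal moves only the unit; keeping `K` fixed is what transfers the criterion
-- between canonical ideals.
omit [IsLocalRing R] [IsNoetherianRing R] in
theorem of_eq_span_mul {J : Ideal R} {v : Qˣ}
    (hJ : coeSubmodule Q J = span R {(v : Q)} * coeSubmodule Q I) :
    IsReducedTo J (v * u) K n where
  mem := by
    rw [hJ]
    exact mul_mem_mul (mem_span_singleton_self _) h.mem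
  eq := by
    rw [hJ, h.eq, ← mul_assoc, span_mul_span, Set.singleton_mul_singleton, Units.val_mul]
  pow_succ_eq := h.pow_succ_eq

end IsReducedTo

variable [IsFractionRing R Q]

omit [IsNoetherianRing R] in
theorem IsReductionOf.exists_isReducedTo {I : Ideal R} {a : R}
    (h : IsReductionOf (Ideal.span {a}) I) (hI : IsMaximalPrimary I)
    (hm : ∃ x ∈ nonZeroDivisors R, x ∈ maximalIdeal R) :
    ∃ (u : Qˣ) (K : Submodule R Q) (n : ℕ), IsReducedTo I u K n := by
  obtain ⟨haI, n, hn⟩ := h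
  obtain ⟨x, hx, hxm⟩ := hm
  rw [← hI] at hxm
  obtain ⟨k, hk⟩ := hxm
  -- `I` contains a power of a nonzerodivisor, so by the reduction equation `a` divides a
  -- nonzerodivisor.
  have ha : a ∈ nonZeroDivisors R := by
    have h1 : (x ^ k) ^ (n + 1) ∈ Ideal.span {a} := by
      have := Ideal.pow_mem_pow hk (n + 1)
      rw [← hn] at this
      exact Ideal.mul_le_left this
    obtain ⟨r, hr⟩ := Ideal.mem_span_singleton.1 h1
    have h2 : a * r ∈ nonZeroDivisors R := by
      rw [← hr]
      exact pow_mem (pow_mem hx k) (n + 1)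
    exact (mul_mem_nonZeroDivisors.1 h2).1
  obtain ⟨u, hu⟩ := map_units Q (⟨a, ha⟩ : nonZeroDivisors R)
  have hW : coeSubmodule Q I = span R {(u : Q)} * (span R {((u⁻¹ : Qˣ) : Q)} * coeSubmodule Q I) :=
    by rw [← mul_assoc, span_unit_mul_span_inv, one_mul]
  refine ⟨u, span R {((u⁻¹ : Qˣ) : Q)} * coeSubmodule Q I, n, ?_, hW, ?_⟩
  · rw [hu]
    exact ⟨a, (Ideal.span_singleton_le_iff_mem _).1 haI, rfl⟩
  · have h1 := congrArg (coeSubmodule Q) hn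
    rw [coeSubmodule_mul, coeSubmodule_pow, coeSubmodule_pow, coeSubmodule_span_singleton] at h1
    change span R {algebraMap R Q (⟨a, ha⟩ : nonZeroDivisors R)} * _ = _ at h1
    rw [← hu] at h1
    generalize coeSubmodule Q I = W at *
    rw [mul_pow, mul_pow, ← h1, pow_succ, mul_assoc, ← mul_assoc (span R {((u⁻¹ : Qˣ) : Q)}),
      span_inv_mul_span_unit, one_mul]

omit [IsNoetherianRing R] in
theorem IsCanonicalIdeal.relLength_eq_one {I : Ideal R} (hI : IsCanonicalIdeal I)
    (hdim : ringKrullDim R = 1) (hm : ∃ x ∈ nonZeroDivisors R, x ∈ maximalIdeal R) :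
    relLength (coeSubmodule Q I) (coeSubmodule Q I / coeSubmodule Q (maximalIdeal R)) = 1 := by
  have hr : LinearMap.range (Algebra.linearMap R Q ∘ₗ I.subtype) = coeSubmodule Q I := by
    rw [LinearMap.range_comp, range_subtype, coeSubmodule]
  have h := hI.canonical.length_ext 1
  rw [hdim, if_pos (by rfl), length_extResidueField_one (Algebra.linearMap R Q ∘ₗ I.subtype)
    ((IsFractionRing.injective R Q).comp Subtype.val_injective) hm, hr] at h
  exact h

variable (Q) in
omit [IsNoetherianRing R] in
theorem cohenMacaulayType_eq (hm : ∃ x ∈ nonZeroDivisors R, x ∈ maximalIdeal R) :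
    cohenMacaulayType R =
      (relLength (1 : Submodule R Q) (1 / coeSubmodule Q (maximalIdeal R))).toNat := by
  rw [cohenMacaulayType, length_extResidueField_one (Algebra.linearMap R Q)
    (IsFractionRing.injective R Q) hm, range_linearMap_eq_one]

theorem isRegFrac_coeSubmodule_maximalIdeal
    (hm : ∃ x ∈ nonZeroDivisors R, x ∈ maximalIdeal R) :
    IsRegFrac (coeSubmodule Q (maximalIdeal R)) := by
  obtain ⟨x, hx, hxm⟩ := hm
  obtain ⟨u, hu⟩ := map_units Q (⟨x, hx⟩ : nonZeroDivisors R)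
  exact ⟨(IsNoetherian.noetherian _).map _, u, x, hxm, hu.symm⟩

omit [IsNoetherianRing R] in
theorem relLength_maximalIdeal_one :
    relLength (coeSubmodule Q (maximalIdeal R)) (1 : Submodule R Q) = 1 := by
  have h := length_quotient_eq_relLength (f := Algebra.linearMap R Q)
    (IsFractionRing.injective R Q) (maximalIdeal R)
  rw [range_linearMap_eq_one] at h
  refine h.symm.trans ?_
  rw [Module.length_eq_one_iff]
  exact isSimpleModule_iff_isCoatom.2 (maximalIdeal.isMaximal R).out

section

variable (hdim : ringKrullDim R = 1) (hreg : ¬ IsRegularLocalRing R)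
  (hm : ∃ x ∈ nonZeroDivisors R, x ∈ maximalIdeal R) {I : Ideal R} (hI : IsCanonicalIdeal I)
  {u : Qˣ} {K : Submodule R Q} {n : ℕ} (h : IsReducedTo I u K n)

include hdim hreg hm hI h

theorem IsReducedTo.hasMinimalMultiplicity_maximalIdeal_iff :
    HasMinimalMultiplicity I (maximalIdeal R) ↔ K * coeSubmodule Q (maximalIdeal R) ≤ 1 := by
  have hfin := isArtinianRing_quotient_span_of_nonZeroDivisor (R := R) hdim
  have hr : LinearMap.range (Algebra.linearMap R Q ∘ₗ (maximalIdeal R).subtype) =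
      coeSubmodule Q (maximalIdeal R) := by
    rw [LinearMap.range_comp, range_subtype, coeSubmodule]
  have hKK : K / K ≤ 1 := h.div_self_le.trans
    (div_self_eq_one hfin h.isRegFrac_coeSubmodule (hI.relLength_eq_one hdim hm).le).le
  rw [hasMinimalMultiplicity_iff hfin hI.primary
    (f := Algebra.linearMap R Q ∘ₗ (maximalIdeal R).subtype)
    ((IsFractionRing.injective R Q).comp Subtype.val_injective)
    (by rw [hr]; exact isRegFrac_coeSubmodule_maximalIdeal hm) h.mem h.span_mul_pow_eq h.eq, hr]
  exact mul_mul_maximalIdeal_le_iff hKK hdim hreg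

theorem IsReducedTo.hasMinimalMultiplicity_dual_maximalIdeal_iff :
    HasMinimalMultiplicity I (Module.Dual R (maximalIdeal R)) ↔
      K * coeSubmodule Q (maximalIdeal R) ≤ 1 := by
  have hfin := isArtinianRing_quotient_span_of_nonZeroDivisor (R := R) hdim
  have hKK : K / K ≤ 1 := h.div_self_le.trans
    (div_self_eq_one hfin h.isRegFrac_coeSubmodule (hI.relLength_eq_one hdim hm).le).le
  let e := LinearEquiv.ofBijective _ (divToHom_bijective (Algebra.linearMap R Q)
    (IsFractionRing.injective R Q) (maximalIdeal R) hm)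
  have hr : LinearMap.range (Submodule.subtype _ ∘ₗ e.symm.toLinearMap) =
      1 / coeSubmodule Q (maximalIdeal R) := by
    rw [LinearMap.range_comp, LinearEquiv.range, Submodule.map_top, range_subtype,
      range_linearMap_eq_one]
  have hreg' : IsRegFrac (1 / coeSubmodule Q (maximalIdeal R)) :=
    isRegFrac_one.div (isRegFrac_coeSubmodule_maximalIdeal hm)
  rw [hasMinimalMultiplicity_iff hfin hI.primary
    (f := Submodule.subtype _ ∘ₗ e.symm.toLinearMap)
    (Subtype.val_injective.comp e.symm.injective)
    (by rw [hr]; exact hreg') h.mem h.span_mul_pow_eq h.eq, hr]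
  exact mul_mul_one_div_maximalIdeal_le_iff hKK hdim hreg

theorem IsReducedTo.exists_isFirstHilbertCoeff_le_iff :
    (∃ e₁ : ℤ, IsFirstHilbertCoeff I e₁ ∧ e₁ ≤ (cohenMacaulayType R : ℤ)) ↔
      K * coeSubmodule Q (maximalIdeal R) ≤ 1 := by
  have hfin := isArtinianRing_quotient_span_of_nonZeroDivisor (R := R) hdim
  have htype := (hI.relLength_eq_one (Q := Q) hdim hm).le
  have hW := h.isRegFrac_coeSubmodule
  have hWW := div_self_eq_one hfin hW htype
  have hmreg := isRegFrac_coeSubmodule_maximalIdeal (Q := Q) hm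
  have hm1 : coeSubmodule Q (maximalIdeal R) ≤ 1 := by
    rw [← coeSubmodule_top (S := Q)]
    exact coeSubmodule_mono Q le_top
  have hmW : coeSubmodule Q (maximalIdeal R) * coeSubmodule Q I ≤ coeSubmodule Q I := by
    simpa using mul_le_mul_left hm1 (coeSubmodule Q I)
  -- Dualizing `mW ⊆ W` into `W` gives `W : mW = (W : W) : m = R : m` over `W : W = R`; dividing
  -- `W/mW` by `u` gives `K/mK`.
  have hdual : relLength 1 (1 / coeSubmodule Q (maximalIdeal R)) =
      relLength (coeSubmodule Q (maximalIdeal R) * K) K := by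
    have h1 := relLength_div_eq hfin hW htype hW (hmreg.mul hW) hmW
    rwa [mul_comm (coeSubmodule Q (maximalIdeal R)) (coeSubmodule Q I), div_mul_eq, hWW, h.eq,
      mul_assoc, relLength_span_unit_mul, mul_comm K] at h1
  -- The shift by two secures an exponent of at least `2`, needed to get `K² ⊆ Kⁿ` in the length
  -- comparison.
  have hn : K ^ (n + 2 + 1) = K ^ (n + 2) := by
    rw [h.pow_eq (k := n + 2 + 1) (by omega), h.pow_eq (k := n + 2) (by omega)]
  have hB : relLength 1 (1 / coeSubmodule Q (maximalIdeal R)) ≠ ⊤ :=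
    relLength_ne_top hfin (isRegFrac_one.div hmreg).1 isRegFrac_one.2
  have hS : relLength 1 (K ^ (n + 2)) ≠ ⊤ :=
    relLength_ne_top hfin (h.isRegFrac.pow _).1 isRegFrac_one.2
  rw [← relLength_pow_le_iff (h.div_self_le.trans hWW.le) h.one_le hfin hdim hreg h.isRegFrac
    hmreg relLength_maximalIdeal_one.le hdual (n := n + 2) (by omega), cohenMacaulayType_eq Q hm]
  simp only [isFirstHilbertCoeff_iff hfin h.mem h.eq hn, exists_eq_left, Nat.cast_le]
  generalize relLength 1 (K ^ (n + 2)) = s at *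
  generalize relLength 1 (1 / coeSubmodule Q (maximalIdeal R)) = r at *
  lift s to ℕ using hS
  lift r to ℕ using hB
  simp

end

end CanonicalIdeal

theorem mainTheorem10 {R : Type u} [CommRing R] [IsLocalRing R] [IsNoetherianRing R]
    (hCM : IsCohenMacaulayLocal R) (hdim : ringKrullDim R = 1)
    (hred : ∀ I : Ideal R, IsMaximalPrimary I → ∃ x : R, IsReductionOf (Ideal.span {x}) I)
    (hgen : IsGenericallyGorenstein R) (hreg : ¬ IsRegularLocalRing R)
    (ω : Ideal R) (hω : IsCanonicalIdeal ω) :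
    (IsAlmostGorenstein R ↔ HasMinimalMultiplicity ω (maximalIdeal R)) ∧
    (HasMinimalMultiplicity ω (maximalIdeal R) ↔
      HasMinimalMultiplicity ω (Module.Dual R (maximalIdeal R))) := by
  have hm := exists_nonZeroDivisor_mem_maximalIdeal hCM hdim
  obtain ⟨a, ha⟩ := hred ω hω.primary
  obtain ⟨u, K, n, h⟩ := ha.exists_isReducedTo (Q := FractionRing R) hω.primary hm
  refine ⟨⟨?_, fun h2 => ?_⟩, ?_⟩
  · rintro ⟨I, e₁, hI, he⟩
    obtain ⟨b, hb⟩ := hred I hI.primary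
    obtain ⟨v, L, k, hL⟩ := hb.exists_isReducedTo (Q := FractionRing R) hI.primary hm
    -- The canonical ideal `I` witnessing almost Gorensteinness need not be `ω`; since `ω = wI` in
    -- `Q`, both are governed by the same `L`.
    obtain ⟨w, hw⟩ := exists_unit_eq_span_mul
      (isArtinianRing_quotient_span_of_nonZeroDivisor hdim) hL.isRegFrac_coeSubmodule
      (hI.relLength_eq_one hdim hm).le h.isRegFrac_coeSubmodule (hω.relLength_eq_one hdim hm).le
    rw [(hL.of_eq_span_mul hw).hasMinimalMultiplicity_maximalIdeal_iff hdim hreg hm hω]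
    exact (hL.exists_isFirstHilbertCoeff_le_iff hdim hreg hm hI).1 ⟨e₁, he⟩
  · rw [h.hasMinimalMultiplicity_maximalIdeal_iff hdim hreg hm hω] at h2
    obtain ⟨e₁, he⟩ := (h.exists_isFirstHilbertCoeff_le_iff hdim hreg hm hω).2 h2
    exact ⟨ω, e₁, hω, he⟩
  · rw [h.hasMinimalMultiplicity_maximalIdeal_iff hdim hreg hm hω,
      h.hasMinimalMultiplicity_dual_maximalIdeal_iff hdim hreg hm hω]
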